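/- Let $\mathbb{H}=\{\tau\in\mathbb{C}:\operatorname{Im}\tau>0\}$, put $q=e^{2\pi i\tau}$ for $\tau\in\mathbb{H}$, and let $\sigma_m(n)=\sum_{d\mid n}d^m$. Let $$E_2(\tau)=1-24\sum_{n=1}^\infty\sigma_1(n)q^n,\qquad E_4(\tau)=1+240\sum_{n=1}^\infty\sigma_3(n)q^n,\qquad E_6(\tau)=1-504\sum_{n=1}^\infty\sigma_5(n)q^n$$ be the normalized Eisenstein series, which are holomorphic functions on $\mathbb{H}$. Then for $k=2,4,6$ each critical point of $E_k$ in $\mathbb{H}$ is simple; that is, if $\tau_0\in\mathbb{H}$ and $E_k'(\tau_0)=0$, then $\tau_0$ is a zero of $E_k'$ of order exactly one. -/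

import Mathlib

open UpperHalfPlane hiding I
open Complex

/-- `τ` is a critical point of `F : ℍ → ℂ`: the complex derivative of `F` vanishes at `τ`.
Here `F ∘ ofComplex : ℂ → ℂ` is a function on the complex plane that agrees with `F` on the open
upper half-plane. -/
def IsCriticalPoint (F : ℍ → ℂ) (τ : ℍ) : Prop :=
  deriv (F ∘ ofComplex) (τ : ℂ) = 0

/-- `τ` is a simple critical point of `F : ℍ → ℂ`: it is a zero of order exactly one of the
derivative of `F` (in particular that derivative is analytic at `τ`). -/
def IsSimpleCriticalPoint (F : ℍ → ℂ) (τ : ℍ) : Prop :=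
  analyticOrderAt (deriv (F ∘ ofComplex)) (τ : ℂ) = 1

/-! The normalized Eisenstein series of Mathlib are given by the classical `q`-series, where
`q = exp (2πiτ)`. -/

theorem eisensteinE2_eq (τ : ℍ) :
    EisensteinSeries.E2 τ = 1 - 24 * ∑' n : ℕ+,
      (ArithmeticFunction.sigma 1 (n : ℕ) : ℂ) * exp (2 * Real.pi * I * τ) ^ (n : ℕ) := by
  simpa [Function.Periodic.qParam] using EisensteinSeries.E2_eq_tsum_cexp τ

theorem eisensteinE4_eq (τ : ℍ) :
    ModularForm.E₄ τ = 1 + 240 * ∑' n : ℕ+,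
      (ArithmeticFunction.sigma 3 (n : ℕ) : ℂ) * exp (2 * Real.pi * I * τ) ^ (n : ℕ) := by
  have h := EisensteinSeries.q_expansion_bernoulli (k := 4) (by norm_num) (by decide) τ
  have hb : bernoulli 4 = -1 / 30 := by
    rw [bernoulli_eq_bernoulli'_of_ne_one (by norm_num), bernoulli'_four]
  rw [hb] at h
  simp only [zpow_natCast] at h
  rw [h]
  norm_num

theorem eisensteinE6_eq (τ : ℍ) :
    ModularForm.E₆ τ = 1 - 504 * ∑' n : ℕ+,
      (ArithmeticFunction.sigma 5 (n : ℕ) : ℂ) * exp (2 * Real.pi * I * τ) ^ (n : ℕ) := by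
  have h := EisensteinSeries.q_expansion_bernoulli (k := 6) (by norm_num) (by decide) τ
  have hb : bernoulli 6 = 1 / 42 := by
    have h5 : bernoulli' 5 = 0 := bernoulli'_eq_zero_of_odd (by decide) (by norm_num)
    rw [bernoulli_eq_bernoulli'_of_ne_one (by norm_num), bernoulli'_def]
    norm_num [Finset.sum_range_succ, h5, bernoulli'_four, Nat.choose]
  rw [hb] at h
  simp only [zpow_natCast] at h
  rw [h]
  norm_num

open Filter Topology Manifold MatrixGroups ModularForm Derivative EisensteinSeries

theorem sigma_le_two_pow_pow (m n : ℕ) :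
    ArithmeticFunction.sigma m (n + 1) ≤ (2 ^ (m + 1)) ^ n := by
  refine (ArithmeticFunction.sigma_le_pow_succ m (n + 1)).trans ?_
  rw [pow_right_comm]
  exact Nat.pow_le_pow_left (Nat.lt_two_pow_self (n := n)) _

theorem norm_tsum_sigma_mul_pow_le (m : ℕ) {q : ℂ} (hq : 2 ^ (m + 1) * ‖q‖ < 1) :
    ‖∑' n : ℕ+, (ArithmeticFunction.sigma m (n : ℕ) : ℂ) * q ^ (n : ℕ)‖ ≤
      ‖q‖ / (1 - 2 ^ (m + 1) * ‖q‖) := by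
  rw [tsum_pnat_eq_tsum_succ (f := fun n : ℕ ↦ (ArithmeticFunction.sigma m n : ℂ) * q ^ n)]
  refine tsum_of_norm_bounded ((hasSum_geometric_of_lt_one (by positivity) hq).mul_left ‖q‖) ?_
  intro n
  rw [norm_mul, norm_pow, Complex.norm_natCast, mul_pow, pow_succ, ← mul_assoc, mul_comm ‖q‖]
  gcongr
  exact_mod_cast sigma_le_two_pow_pow m n

theorem norm_exp_two_pi_I_mul (τ : ℍ) :
    ‖exp (2 * Real.pi * I * τ)‖ = Real.exp (-(2 * Real.pi * τ.im)) := by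
  rw [Complex.norm_exp]
  simp

theorem tendsto_one_add_tsum_sigma (F : ℍ → ℂ) (c : ℂ) (m : ℕ)
    (hF : ∀ τ : ℍ, F τ = 1 + c * ∑' n : ℕ+,
      (ArithmeticFunction.sigma m (n : ℕ) : ℂ) * exp (2 * Real.pi * I * τ) ^ (n : ℕ)) :
    Tendsto F atImInfty (𝓝 1) := by
  have hr : Tendsto (fun τ : ℍ ↦ ‖exp (2 * Real.pi * I * τ)‖) atImInfty (𝓝 0) := by
    simp_rw [norm_exp_two_pi_I_mul]
    exact Real.tendsto_exp_neg_atTop_nhds_zero.comp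
      (tendsto_comap.const_mul_atTop (by positivity : 0 < 2 * Real.pi))
  have hr' : Tendsto (fun τ : ℍ ↦ 2 ^ (m + 1) * ‖exp (2 * Real.pi * I * τ)‖) atImInfty (𝓝 0) := by
    simpa using hr.const_mul (2 ^ (m + 1))
  have hlim : Tendsto (fun τ : ℍ ↦ ‖exp (2 * Real.pi * I * τ)‖ /
      (1 - 2 ^ (m + 1) * ‖exp (2 * Real.pi * I * τ)‖)) atImInfty (𝓝 0) := by
    simpa [Pi.div_def] using hr.div (hr'.const_sub 1) (by norm_num)
  have hsum := squeeze_zero_norm' (f := fun τ : ℍ ↦ ∑' n : ℕ+,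
      (ArithmeticFunction.sigma m (n : ℕ) : ℂ) * exp (2 * Real.pi * I * τ) ^ (n : ℕ))
    (by
      filter_upwards [hr'.eventually_lt_const one_pos] with τ hτ
      exact norm_tsum_sigma_mul_pow_le m hτ) hlim
  rw [funext hF]
  simpa using (hsum.const_mul c).const_add 1

theorem tendsto_E2_atImInfty : Tendsto E2 atImInfty (𝓝 1) :=
  tendsto_one_add_tsum_sigma E2 (-24) 1 fun τ ↦ by rw [eisensteinE2_eq τ]; ring

theorem tendsto_E4_atImInfty : Tendsto E₄ atImInfty (𝓝 1) :=
  tendsto_one_add_tsum_sigma E₄ 240 3 eisensteinE4_eq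

theorem tendsto_E6_atImInfty : Tendsto E₆ atImInfty (𝓝 1) :=
  tendsto_one_add_tsum_sigma E₆ (-504) 5 fun τ ↦ by rw [eisensteinE6_eq τ]; ring

/-- The derivative of a holomorphic function which is bounded at `i∞` tends to zero there. -/
theorem tendsto_normalizedDeriv_zero {F : ℍ → ℂ} (hF : MDiff F) (hb : IsBoundedAtImInfty F) :
    Tendsto (D F) atImInfty (𝓝 0) := by
  obtain ⟨M, A, hM⟩ := isBoundedAtImInfty_iff.mp hb
  rw [mdifferentiable_iff] at hF
  have him : Tendsto UpperHalfPlane.im atImInfty atTop := tendsto_comap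
  have hlim : Tendsto (fun τ : ℍ ↦ M / (τ.im - max A 0 - 1)) atImInfty (𝓝 0) :=
    tendsto_const_nhds.div_atTop
      (tendsto_atTop_add_const_right _ _ (tendsto_atTop_add_const_right _ _ him))
  have hderiv : Tendsto (fun τ : ℍ ↦ deriv (F ∘ ofComplex) τ) atImInfty (𝓝 0) := by
    refine squeeze_zero_norm' ?_ hlim
    filter_upwards [him.eventually_gt_atTop (max A 0 + 1)] with τ hτ
    have him_ball : ∀ z ∈ Metric.closedBall (τ : ℂ) (τ.im - max A 0 - 1), max A 0 < z.im := by
      intro z hz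
      have h1 := (Complex.abs_im_le_norm (z - τ)).trans (mem_closedBall_iff_norm.mp hz)
      rw [Complex.sub_im, UpperHalfPlane.coe_im] at h1
      linarith [(abs_le.mp h1).1]
    refine Complex.norm_deriv_le_of_forall_mem_sphere_norm_le (by linarith) ?_ ?_
    · refine DifferentiableOn.diffContOnCl (hF.mono fun z hz ↦ ?_)
      exact (le_max_right A 0).trans_lt (him_ball z (Metric.closure_ball_subset_closedBall hz))
    · intro z hz
      have hz' := him_ball z (Metric.sphere_subset_closedBall hz)
      have hz0 : 0 < z.im := (le_max_right A 0).trans_lt hz'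
      rw [Function.comp_apply, ofComplex_apply_of_im_pos hz0]
      exact hM _ ((le_max_left A 0).trans hz'.le)
  have h := hderiv.const_mul ((2 * Real.pi * I)⁻¹)
  rwa [mul_zero] at h

theorem tendsto_serreDerivative {F : ℍ → ℂ} (k : ℂ) (hF : MDiff F)
    (hlim : Tendsto F atImInfty (𝓝 1)) :
    Tendsto (serreDerivative k F) atImInfty (𝓝 (-(k * 12⁻¹))) := by
  have h := (tendsto_normalizedDeriv_zero hF (hlim.isBigO_one ℝ)).sub
    ((tendsto_E2_atImInfty.const_mul (k * 12⁻¹)).mul hlim)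
  simpa [serreDerivative_eq] using h

/-- In a weight where the space of level one modular forms is a line, a holomorphic slash-invariant
function with a limit at `i∞` is determined by that limit. -/
theorem eq_smul_of_rank_one {k : ℤ} (hk : Module.rank ℂ (ModularForm 𝒮ℒ k) = 1)
    (G : ModularForm 𝒮ℒ k) (hG : Tendsto G atImInfty (𝓝 1)) {f : ℍ → ℂ} {a : ℂ} (hf : MDiff f)
    (hslash : ∀ γ : SL(2, ℤ), f ∣[k] γ = f) (hlim : Tendsto f atImInfty (𝓝 a)) (τ : ℍ) :
    f τ = a * G τ := by
  let f' : ModularForm 𝒮ℒ k :=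
    { toFun := f
      slash_action_eq' := fun _ ⟨γ, hγ⟩ ↦ hγ ▸ hslash γ
      holo' := hf
      bdd_at_cusps' := fun {c} hc ↦ by
        rw [OnePoint.isBoundedAt_iff_forall_SL2Z hc]
        intro γ _
        rw [hslash γ]
        exact hlim.isBigO_one ℝ }
  have hG0 : G ≠ 0 := by
    rintro rfl
    exact one_ne_zero (tendsto_nhds_unique hG (tendsto_const_nhds (x := (0 : ℂ))))
  obtain ⟨c, hc⟩ := (finrank_eq_one_iff_of_nonzero' G hG0).mp
    (Module.rank_eq_one_iff_finrank_eq_one.mp hk) f'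
  have hc' : ∀ z, f z = c * G z := fun z ↦ (DFunLike.congr_fun hc z).symm
  have hca : a = c := by
    refine tendsto_nhds_unique hlim ?_
    rw [funext hc']
    simpa using hG.const_mul c
  rw [hca, hc']

theorem slash_eq_self (k : ℤ) (f : ModularForm 𝒮ℒ k) (γ : SL(2, ℤ)) : (f : ℍ → ℂ) ∣[k] γ = f :=
  SlashInvariantForm.slash_action_eqn f _ ⟨γ, rfl⟩

theorem E4_mdifferentiable : MDiff (E₄ : ℍ → ℂ) := E₄.holo'

theorem E6_mdifferentiable : MDiff (E₆ : ℍ → ℂ) := E₆.holo'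

/-- Ramanujan's differential equation for `E₄`. -/
theorem normalizedDeriv_E4 (τ : ℍ) : D E₄ τ = (E2 τ * E₄ τ - E₆ τ) / 3 := by
  have h := eq_smul_of_rank_one levelOne_weight_six_rank_one E₆ tendsto_E6_atImInfty
    (serreDerivative_mdifferentiable ((4 : ℤ) : ℂ) E4_mdifferentiable)
    (fun γ ↦ serreDerivative_slash_invariant (k := 4) E4_mdifferentiable (slash_eq_self 4 E₄ γ))
    (tendsto_serreDerivative _ E4_mdifferentiable tendsto_E4_atImInfty) τ
  have h' : D E₄ τ - ((4 : ℤ) : ℂ) * 12⁻¹ * E2 τ * E₄ τ = -(((4 : ℤ) : ℂ) * 12⁻¹) * E₆ τ := h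
  push_cast at h'
  linear_combination h'

/-- Ramanujan's differential equation for `E₆`. -/
theorem normalizedDeriv_E6 (τ : ℍ) : D E₆ τ = (E2 τ * E₆ τ - E₄ τ ^ 2) / 2 := by
  have h := eq_smul_of_rank_one (k := 8)
    ((dimension_level_one 8 (by decide)).trans (by norm_num [Nat.ModEq])) (E₄.mul E₄)
    (mul_one (1 : ℂ) ▸ tendsto_E4_atImInfty.mul tendsto_E4_atImInfty)
    (serreDerivative_mdifferentiable ((6 : ℤ) : ℂ) E6_mdifferentiable)
    (fun γ ↦ serreDerivative_slash_invariant (k := 6) E6_mdifferentiable (slash_eq_self 6 E₆ γ))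
    (tendsto_serreDerivative _ E6_mdifferentiable tendsto_E6_atImInfty) τ
  have h' : D E₆ τ - ((6 : ℤ) : ℂ) * 12⁻¹ * E2 τ * E₆ τ =
    -(((6 : ℤ) : ℂ) * 12⁻¹) * (E₄ τ * E₄ τ) := h
  push_cast at h'
  linear_combination h'

/-- The transformation law of `E2`, with the non-modular part written through
`(2 * π * I)⁻¹`. -/
theorem E2_slash_apply (γ : SL(2, ℤ)) (z : ℍ) :
    (E2 ∣[(2 : ℤ)] γ) z = E2 z + 12 * (2 * Real.pi * I)⁻¹ * (γ 1 0 / denom γ z) := by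
  have hπ : (Real.pi : ℂ) ≠ 0 := by exact_mod_cast Real.pi_ne_zero
  have hd := denom_ne_zero γ z
  rw [E2_slash_action]
  simp only [Pi.sub_apply, Pi.smul_apply, smul_eq_mul, D2, riemannZeta_two]
  field_simp
  linear_combination (-12) * (γ 1 0 : ℂ) * I_sq

theorem serreDerivative_one_E2_slash (γ : SL(2, ℤ)) :
    serreDerivative 1 E2 ∣[(4 : ℤ)] γ = serreDerivative 1 E2 := by
  ext z
  have hd := denom_ne_zero γ z
  set β : ℂ := (2 * Real.pi * I)⁻¹ with hβ
  have hu : HasDerivAt (fun w : ℂ ↦ (γ 1 0 : ℂ) * denom γ w ^ (-1 : ℤ))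
      (-((γ 1 0 : ℂ) / denom γ z) ^ 2) z := by
    refine ((hasDerivAt_denom_zpow (γ : GL (Fin 2) ℝ) (-1) z).const_mul (γ 1 0 : ℂ)).congr_deriv ?_
    rw [show (-1 - 1 : ℤ) = -(2 : ℕ) by norm_num, zpow_neg, zpow_natCast]
    simp
    field_simp
  have hE : HasDerivAt (E2 ∘ ofComplex) (deriv (E2 ∘ ofComplex) z) z :=
    (mdifferentiableAt_iff.mp (E2_mdifferentiable z)).hasDerivAt
  have hD : D (E2 ∣[(2 : ℤ)] γ) z = D E2 z - 12 * β ^ 2 * ((γ 1 0 : ℂ) / denom γ z) ^ 2 := by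
    have h1 : deriv ((E2 ∣[(2 : ℤ)] γ) ∘ ofComplex) z = deriv (E2 ∘ ofComplex) z +
        12 * β * (-((γ 1 0 : ℂ) / denom γ z) ^ 2) := by
      refine HasDerivAt.deriv ((hE.add (hu.const_mul (12 * β))).congr_of_eventuallyEq ?_)
      filter_upwards [isOpen_upperHalfPlaneSet.mem_nhds z.im_pos] with w hw
      have hw' : ((ofComplex w : ℍ) : ℂ) = w := by rw [ofComplex_apply_of_im_pos hw]
      simp [E2_slash_apply, hw', β, div_eq_mul_inv]
    simp only [normalizedDerivOfComplex, h1]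
    ring
  have hS := congrFun (normalizedDerivOfComplex_SL_slash (k := 2) E2_mdifferentiable (γ := γ)) z
  rw [hD, Pi.sub_apply, E2_slash_apply, ← hβ] at hS
  have hmul : ((E2 * E2) ∣[(4 : ℤ)] γ) z = (E2 ∣[(2 : ℤ)] γ) z * (E2 ∣[(2 : ℤ)] γ) z :=
    congrFun (ModularForm.mul_slash_SL2 2 2 γ E2 E2) z
  have hL : (serreDerivative 1 E2 ∣[(4 : ℤ)] γ) z =
      (D E2 ∣[(4 : ℤ)] γ) z - 12⁻¹ * ((E2 ∣[(2 : ℤ)] γ) z * (E2 ∣[(2 : ℤ)] γ) z) := by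
    rw [← hmul]
    simp only [SL_slash_apply, serreDerivative_apply, Pi.mul_apply]
    ring
  rw [hL, E2_slash_apply, ← hβ, serreDerivative_apply]
  norm_num at hS
  linear_combination -hS

/-- Ramanujan's differential equation for `E₂`. -/
theorem normalizedDeriv_E2 (τ : ℍ) : D E2 τ = (E2 τ ^ 2 - E₄ τ) / 12 := by
  have h := eq_smul_of_rank_one levelOne_weight_four_rank_one E₄ tendsto_E4_atImInfty
    (serreDerivative_mdifferentiable 1 E2_mdifferentiable) serreDerivative_one_E2_slash
    (tendsto_serreDerivative _ E2_mdifferentiable tendsto_E2_atImInfty) τ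
  rw [serreDerivative_apply] at h
  linear_combination h

theorem E4_cube_ne_E6_sq (τ : ℍ) : E₄ τ ^ 3 ≠ E₆ τ ^ 2 := fun h ↦
  discriminant_ne_zero τ (by rw [discriminant_eq_E₄_cube_sub_E₆_sq, h, sub_self, zero_div])

/-- A zero of `E₄` has small imaginary part. -/
theorem im_lt_of_E4_eq_zero {τ : ℍ} (h : E₄ τ = 0) : τ.im < 6 / 5 := by
  by_contra! him
  have hq : Real.exp (-(2 * Real.pi * τ.im)) ≤ 1 / 512 := by
    have h1 : (7 : ℝ) ≤ 2 * Real.pi * τ.im := by nlinarith [Real.pi_gt_three]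
    calc Real.exp (-(2 * Real.pi * τ.im)) ≤ Real.exp (-7) := Real.exp_le_exp.mpr (by linarith)
      _ = (Real.exp 1 ^ 7)⁻¹ := by rw [← Real.exp_nat_mul, ← Real.exp_neg]; norm_num
      _ ≤ (2.7 ^ 7)⁻¹ := by
        gcongr
        linarith [Real.exp_one_gt_d9]
      _ ≤ 1 / 512 := by norm_num
  rw [← norm_exp_two_pi_I_mul] at hq
  have hb := norm_tsum_sigma_mul_pow_le 3 (q := exp (2 * Real.pi * I * τ))
    (by norm_num; linarith)
  rw [show (2 : ℝ) ^ (3 + 1) = 16 by norm_num] at hb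
  rw [le_div_iff₀ (by linarith)] at hb
  have h1 : (1 : ℝ) = 240 * ‖∑' n : ℕ+, (ArithmeticFunction.sigma 3 (n : ℕ) : ℂ) *
      exp (2 * Real.pi * I * τ) ^ (n : ℕ)‖ := by
    have := eisensteinE4_eq τ
    rw [h] at this
    rw [← norm_one (α := ℂ), show (1 : ℂ) = -(240 * ∑' n : ℕ+, _) from
      eq_neg_of_add_eq_zero_left this.symm, norm_neg, norm_mul]
    norm_num
  have h2 := mul_nonneg (norm_nonneg (∑' n : ℕ+, (ArithmeticFunction.sigma 3 (n : ℕ) : ℂ) *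
    exp (2 * Real.pi * I * τ) ^ (n : ℕ))) (sub_nonneg.mpr hq)
  linarith

theorem norm_E2_sub_one_le {τ : ℍ} (h : 3 ≤ 4 * τ.im ^ 2) : ‖E2 τ - 1‖ ≤ 1 / 6 := by
  have him : (43 / 50 : ℝ) ≤ τ.im := by nlinarith [τ.im_pos]
  have hq : Real.exp (-(2 * Real.pi * τ.im)) ≤ 1 / 148 := by
    have h1 : (5 : ℝ) ≤ 2 * Real.pi * τ.im := by nlinarith [Real.pi_gt_three]
    calc Real.exp (-(2 * Real.pi * τ.im)) ≤ Real.exp (-5) := Real.exp_le_exp.mpr (by linarith)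
      _ = (Real.exp 1 ^ 5)⁻¹ := by rw [← Real.exp_nat_mul, ← Real.exp_neg]; norm_num
      _ ≤ (2.718 ^ 5)⁻¹ := by
        gcongr
        linarith [Real.exp_one_gt_d9]
      _ ≤ 1 / 148 := by norm_num
  rw [← norm_exp_two_pi_I_mul] at hq
  have hb := norm_tsum_sigma_mul_pow_le 1 (q := exp (2 * Real.pi * I * τ))
    (by norm_num; linarith)
  rw [show (2 : ℝ) ^ (1 + 1) = 4 by norm_num] at hb
  rw [le_div_iff₀ (by linarith)] at hb
  rw [eisensteinE2_eq, sub_sub_cancel_left, norm_neg, norm_mul]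
  norm_num
  have h2 := mul_nonneg (norm_nonneg (∑' n : ℕ+, (ArithmeticFunction.sigma 1 (n : ℕ) : ℂ) *
    exp (2 * Real.pi * I * τ) ^ (n : ℕ))) (sub_nonneg.mpr hq)
  linarith

/-- The non-holomorphic modular Eisenstein series of weight two. -/
noncomputable def E2Star (τ : ℍ) : ℂ := E2 τ - 3 / (Real.pi * τ.im)

theorem E2Star_smul (γ : SL(2, ℤ)) (τ : ℍ) :
    E2Star (γ • τ) = denom γ τ ^ 2 * E2Star τ := by
  have hd := denom_ne_zero γ τ
  have hπ : (Real.pi : ℂ) ≠ 0 := by exact_mod_cast Real.pi_ne_zero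
  have hy : (τ.im : ℂ) ≠ 0 := by exact_mod_cast τ.im_pos.ne'
  have h := E2_slash_apply γ τ
  rw [SL_slash_apply, zpow_neg, zpow_ofNat, ← div_eq_mul_inv, div_eq_iff (pow_ne_zero _ hd)] at h
  have him : ((γ • τ).im : ℂ) = τ.im / (denom γ τ * (starRingEnd ℂ) (denom γ τ)) := by
    rw [ModularGroup.im_smul_eq_div_normSq, Complex.mul_conj]
    push_cast
    rfl
  have hconj : (starRingEnd ℂ) (denom γ τ) = denom γ τ - 2 * I * γ 1 0 * τ.im := by
    rw [ModularGroup.denom_apply]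
    apply Complex.ext <;> simp
    ring
  rw [E2Star, E2Star, h, him, hconj]
  field_simp
  linear_combination 12 * (γ 1 0 : ℂ) * τ.im * I_sq

/-- `E₂` and `E₄` have no common zero. -/
theorem E2_ne_zero_of_E4_eq_zero {τ : ℍ} (h4 : E₄ τ = 0) : E2 τ ≠ 0 := by
  intro h2
  obtain ⟨γ, hγ⟩ := ModularGroup.exists_smul_mem_fd τ
  have him := ModularGroup.three_le_four_mul_im_sq_of_mem_fd hγ
  have h4' : E₄ (γ • τ) = 0 := by
    have h := congrFun (slash_eq_self 4 E₄ γ) τ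
    rw [SL_slash_apply, h4, mul_eq_zero] at h
    exact h.resolve_right (zpow_ne_zero _ (denom_ne_zero γ τ))
  have hlt := im_lt_of_E4_eq_zero h4'
  have hE2 := norm_E2_sub_one_le him
  have hnorm : ‖E2Star (γ • τ)‖ = 3 / (Real.pi * (γ • τ).im) := by
    rw [E2Star_smul, E2Star, h2, zero_sub, norm_mul, norm_neg, norm_pow,
      ModularGroup.im_smul_eq_div_normSq, Complex.normSq_eq_norm_sq, norm_div, norm_mul,
      Complex.norm_real, Complex.norm_real, Real.norm_of_nonneg Real.pi_pos.le,
      Real.norm_of_nonneg τ.im_pos.le]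
    have := norm_ne_zero_iff.mpr (denom_ne_zero γ τ)
    norm_num
    field_simp
  set s : ℝ := 3 / (Real.pi * (γ • τ).im) with hs
  set y : ℝ := (γ • τ).im with hy
  have hy0 : 0 < y := (γ • τ).im_pos
  have hy1 : (43 / 50 : ℝ) ≤ y := by nlinarith
  have hπy : 0 < Real.pi * y := by positivity
  have hs1 : s ≤ 6 / 5 := by
    rw [hs, div_le_iff₀ hπy]
    nlinarith [Real.pi_gt_three]
  have hs2 : 3 / 4 ≤ s := by
    rw [hs, le_div_iff₀ hπy]
    nlinarith [Real.pi_lt_d2]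
  have hE : E2Star (γ • τ) = (E2 (γ • τ) - 1) + ((1 - s : ℝ) : ℂ) := by
    rw [E2Star, hs]
    push_cast
    ring
  have hle : s ≤ 1 / 6 + |1 - s| := by
    calc s = ‖E2Star (γ • τ)‖ := hnorm.symm
      _ ≤ ‖E2 (γ • τ) - 1‖ + ‖((1 - s : ℝ) : ℂ)‖ := hE ▸ norm_add_le _ _
      _ ≤ 1 / 6 + |1 - s| := by rw [Complex.norm_real, Real.norm_eq_abs]; gcongr
  rcases abs_cases (1 - s) with ⟨h, _⟩ | ⟨h, _⟩ <;> linarith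

theorem isSimpleCriticalPoint_of_normalizedDeriv_ne_zero {F : ℍ → ℂ} (hF : MDiff F) {τ : ℍ}
    (h0 : IsCriticalPoint F τ) (h1 : D (D F) τ ≠ 0) : IsSimpleCriticalPoint F τ := by
  have hd := (UpperHalfPlane.mdifferentiable_iff.mp hF).deriv isOpen_upperHalfPlaneSet
  refine AnalyticAt.analyticOrderAt_eq_one_of_zero_deriv_ne_zero
    (hd.analyticAt (isOpen_upperHalfPlaneSet.mem_nhds τ.im_pos)) h0 fun h2 ↦ h1 ?_
  have he : D F ∘ ofComplex =ᶠ[𝓝 (τ : ℂ)]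
      fun z ↦ (2 * Real.pi * I)⁻¹ * deriv (F ∘ ofComplex) z := by
    filter_upwards [isOpen_upperHalfPlaneSet.mem_nhds τ.im_pos] with z hz
    rw [Function.comp_apply, normalizedDerivOfComplex, ofComplex_apply_of_im_pos hz]
  rw [normalizedDerivOfComplex, he.deriv_eq, deriv_const_mul_field, h2, mul_zero, mul_zero]

theorem normalizedDeriv_eq_zero {F : ℍ → ℂ} {τ : ℍ} (h : IsCriticalPoint F τ) : D F τ = 0 := by
  rw [normalizedDerivOfComplex, show deriv (F ∘ ofComplex) τ = 0 from h, mul_zero]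

theorem normalizedDeriv_normalizedDeriv_E2 (τ : ℍ) :
    D (D E2) τ = (2 * E2 τ * D E2 τ - D E₄ τ) / 12 := by
  have h : D E2 = (12⁻¹ : ℂ) • (E2 * E2 - E₄) := by
    ext z
    rw [normalizedDeriv_E2]
    simp only [Pi.smul_apply, Pi.sub_apply, Pi.mul_apply, smul_eq_mul]
    ring
  have h2 := E2_mdifferentiable.mul E2_mdifferentiable
  rw [h, normalizedDerivOfComplex_smul _ _ (h2.sub E4_mdifferentiable),
    normalizedDerivOfComplex_sub _ _ h2 E4_mdifferentiable,
    normalizedDerivOfComplex_mul _ _ E2_mdifferentiable E2_mdifferentiable, ← h]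
  simp only [Pi.smul_apply, Pi.sub_apply, Pi.add_apply, Pi.mul_apply, smul_eq_mul]
  ring

theorem normalizedDeriv_normalizedDeriv_E4 (τ : ℍ) :
    D (D E₄) τ = (D E2 τ * E₄ τ + E2 τ * D E₄ τ - D E₆ τ) / 3 := by
  have h : D E₄ = (3⁻¹ : ℂ) • (E2 * E₄ - E₆) := by
    ext z
    rw [normalizedDeriv_E4]
    simp only [Pi.smul_apply, Pi.sub_apply, Pi.mul_apply, smul_eq_mul]
    ring
  have h2 := E2_mdifferentiable.mul E4_mdifferentiable
  rw [h, normalizedDerivOfComplex_smul _ _ (h2.sub E6_mdifferentiable),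
    normalizedDerivOfComplex_sub _ _ h2 E6_mdifferentiable,
    normalizedDerivOfComplex_mul _ _ E2_mdifferentiable E4_mdifferentiable, ← h]
  simp only [Pi.smul_apply, Pi.sub_apply, Pi.add_apply, Pi.mul_apply, smul_eq_mul]
  ring

theorem normalizedDeriv_normalizedDeriv_E6 (τ : ℍ) :
    D (D E₆) τ = (D E2 τ * E₆ τ + E2 τ * D E₆ τ - 2 * E₄ τ * D E₄ τ) / 2 := by
  have h : D E₆ = (2⁻¹ : ℂ) • (E2 * E₆ - E₄ * E₄) := by
    ext z
    rw [normalizedDeriv_E6]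
    simp only [Pi.smul_apply, Pi.sub_apply, Pi.mul_apply, smul_eq_mul]
    ring
  have h2 := E2_mdifferentiable.mul E6_mdifferentiable
  have h4 : MDiff (E₄ * E₄ : ℍ → ℂ) := E4_mdifferentiable.mul E4_mdifferentiable
  rw [h, normalizedDerivOfComplex_smul _ _ (h2.sub h4),
    normalizedDerivOfComplex_sub _ _ h2 h4,
    normalizedDerivOfComplex_mul _ _ E2_mdifferentiable E6_mdifferentiable,
    normalizedDerivOfComplex_mul _ _ E4_mdifferentiable E4_mdifferentiable, ← h]
  simp only [Pi.smul_apply, Pi.sub_apply, Pi.add_apply, Pi.mul_apply, smul_eq_mul]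
  ring

theorem isSimpleCriticalPoint_E2 {τ : ℍ} (h : IsCriticalPoint E2 τ) :
    IsSimpleCriticalPoint E2 τ := by
  refine isSimpleCriticalPoint_of_normalizedDeriv_ne_zero E2_mdifferentiable h fun h2 ↦ ?_
  have h1 := normalizedDeriv_eq_zero h
  rw [normalizedDeriv_normalizedDeriv_E2, h1, normalizedDeriv_E4] at h2
  rw [normalizedDeriv_E2] at h1
  refine E4_cube_ne_E6_sq τ ?_
  have hQ : E₄ τ = E2 τ ^ 2 := by linear_combination -12 * h1
  have hR : E₆ τ = E2 τ * E₄ τ := by linear_combination 36 * h2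
  rw [hR, hQ]
  ring

theorem isSimpleCriticalPoint_E4 {τ : ℍ} (h : IsCriticalPoint E₄ τ) :
    IsSimpleCriticalPoint E₄ τ := by
  refine isSimpleCriticalPoint_of_normalizedDeriv_ne_zero E4_mdifferentiable h fun h2 ↦ ?_
  have h1 := normalizedDeriv_eq_zero h
  rw [normalizedDeriv_normalizedDeriv_E4, h1, normalizedDeriv_E2, normalizedDeriv_E6] at h2
  rw [normalizedDeriv_E4] at h1
  refine E4_cube_ne_E6_sq τ ?_
  have hR : E₆ τ = E2 τ * E₄ τ := by linear_combination -3 * h1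
  rw [hR] at h2 ⊢
  linear_combination (36 / 5) * E₄ τ * h2

theorem isSimpleCriticalPoint_E6 {τ : ℍ} (h : IsCriticalPoint E₆ τ) :
    IsSimpleCriticalPoint E₆ τ := by
  refine isSimpleCriticalPoint_of_normalizedDeriv_ne_zero E6_mdifferentiable h fun h2 ↦ ?_
  have h1 := normalizedDeriv_eq_zero h
  rw [normalizedDeriv_normalizedDeriv_E6, h1, normalizedDeriv_E2, normalizedDeriv_E4] at h2
  rw [normalizedDeriv_E6] at h1
  have hne := E4_cube_ne_E6_sq τ
  have hQ : E2 τ * E₆ τ = E₄ τ ^ 2 := by linear_combination 2 * h1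
  have h3 : E₄ τ * (E₆ τ - E2 τ * E₄ τ) = 0 := by
    linear_combination (24 / 7) * h2 - E2 τ / 7 * hQ
  rcases mul_eq_zero.mp h3 with h4 | h4
  · have h6 : E₆ τ ≠ 0 := fun h6 ↦ hne (by rw [h4, h6]; norm_num)
    refine E2_ne_zero_of_E4_eq_zero h4 ((mul_eq_zero.mp ?_).resolve_right h6)
    rw [hQ, h4, zero_pow two_ne_zero]
  · refine hne ?_
    linear_combination (-E₄ τ) * hQ - E₆ τ * h4

theorem proposition4p2 :
    (∀ τ : ℍ, IsCriticalPoint EisensteinSeries.E2 τ →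
      IsSimpleCriticalPoint EisensteinSeries.E2 τ) ∧
    (∀ τ : ℍ, IsCriticalPoint (ModularForm.E₄ : ℍ → ℂ) τ →
      IsSimpleCriticalPoint (ModularForm.E₄ : ℍ → ℂ) τ) ∧
    (∀ τ : ℍ, IsCriticalPoint (ModularForm.E₆ : ℍ → ℂ) τ →
      IsSimpleCriticalPoint (ModularForm.E₆ : ℍ → ℂ) τ) :=
  ⟨fun _ ↦ isSimpleCriticalPoint_E2, fun _ ↦ isSimpleCriticalPoint_E4,
    fun _ ↦ isSimpleCriticalPoint_E6⟩
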